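/- Let $f:(0,\infty)\to\mathbb{R}$ be a function. For positive semi-definite operators $X,Y$ on a finite-dimensional complex Hilbert space $\mathcal{H}$ define the optimized quantum $f$-divergence $$\widetilde{Q}_f(X\Vert Y)=\sup_{\tau>0,\ \operatorname{Tr}\tau\le 1,\ \varepsilon>0}\widetilde{Q}_f(X\Vert Y+\varepsilon\Pi_Y^{\perp};\tau)\in[-\infty,+\infty],$$ where $\Pi_Y^\perp$ is the orthogonal projection onto $\ker Y$, $\tau$ ranges over the positive definite operators on $\mathcal{H}$ with trace at most $1$, and, for positive definite $Z$ and $\tau$, $$\widetilde{Q}_f(X\Vert Z;\tau)=\langle\varphi^X|f(\tau^{-1}\otimes Z^{T})|\varphi^X\rangle,\qquad |\varphi^X\rangle=(X^{1/2}\otimes I)\sum_i|i\rangle\otimes|i\rangle,$$ with $\{|i\rangle\}_i$ an orthonormal basis of $\mathcal{H}$ and $T$ the transpose with respect to this basis. Let $\mathcal{H}_S$ and $\mathcal{H}_R$ be finite-dimensional complex Hilbert spaces, let $U:\mathcal{H}_S\to\mathcal{H}_R$ be a linear isometry, and let $X,Y$ be positive semi-definite operators on $\mathcal{H}_S$. Let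 the divergences be computed with respect to arbitrary orthonormal bases of $\mathcal{H}_S$ and $\mathcal{H}_R$. (1) If $f$ is operator anti-monotone on $(0,\infty)$, i.e. $A\le B$ implies $f(B)\le f(A)$ for all positive definite matrices $A,B$ of the same (arbitrary) finite size, then $$\widetilde{Q}_f(X\Vert Y)=\widetilde{Q}_f(UXU^\dagger\Vert UYU^\dagger).$$ (2) If $f$ is merely continuous on $(0,\infty)$, then $$\widetilde{Q}_f(X\Vert Y)\le\widetilde{Q}_f(UXU^\dagger\Vert UYU^\dagger).$$ -/

import Mathlib

open scoped Kronecker Matrix InnerProductSpace ComplexOrder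

noncomputable section

namespace OptFDiv

/-- A function `f` on `(0, ∞)` is operator anti-monotone: `A ≤ B` implies `f(B) ≤ f(A)` for all
positive definite matrices `A`, `B` of every size. Only the values of `f` on `(0, ∞)` matter. -/
def OperatorAntitone (f : ℝ → ℝ) : Prop :=
  ∀ (n : ℕ) (A B : Matrix (Fin n) (Fin n) ℂ), A.PosDef → B.PosDef →
    (B - A).PosSemidef → (cfc f A - cfc f B).PosSemidef

/-- Positive definite operators (`τ > 0`). -/
def IsPosDef {H : Type*} [NormedAddCommGroup H] [InnerProductSpace ℂ H] (τ : H →ₗ[ℂ] H) : Prop :=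
  τ.IsSymmetric ∧ ∀ x : H, x ≠ 0 → 0 < (⟪τ x, x⟫_ℂ).re

/-- The orthogonal projection onto the kernel of `Y`, i.e. `Π_Y^⊥`. -/
def kerProj {H : Type*} [NormedAddCommGroup H] [InnerProductSpace ℂ H] [FiniteDimensional ℂ H]
    (Y : H →ₗ[ℂ] H) : H →ₗ[ℂ] H :=
  ((LinearMap.ker Y).starProjection : H →L[ℂ] H)

/-- The coordinates of `|Γ⟩ = ∑ i, |i⟩ ⊗ |i⟩` in the product basis. -/
def gammaVec (ι : Type*) [DecidableEq ι] : ι × ι → ℂ :=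
  fun p => if p.1 = p.2 then 1 else 0

/-- The coordinates of `|φ^X⟩ = (X^{1/2} ⊗ I) |Γ⟩` in the product basis, where `M` is the matrix
of `X`. -/
def phiVec {ι : Type*} [Fintype ι] [DecidableEq ι] (M : Matrix ι ι ℂ) : ι × ι → ℂ :=
  (cfc Real.sqrt M ⊗ₖ (1 : Matrix ι ι ℂ)) *ᵥ gammaVec ι

/-- `Q̃_f(X‖Z;τ) = ⟨φ^X| f(τ⁻¹ ⊗ Zᵀ) |φ^X⟩`, computed in the orthonormal basis `b` of `H` and
the product basis of the tensor product of `H` with its copy. The number is real, since `f` of a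
Hermitian matrix is Hermitian, so taking the real part loses nothing. -/
def optFDivAt {ι H : Type*} [Fintype ι] [DecidableEq ι] [NormedAddCommGroup H]
    [InnerProductSpace ℂ H] [FiniteDimensional ℂ H] (b : OrthonormalBasis ι ℂ H)
    (f : ℝ → ℝ) (X Z τ : H →ₗ[ℂ] H) : ℝ :=
  (star (phiVec (LinearMap.toMatrixOrthonormal b X)) ⬝ᵥ
    (cfc f ((LinearMap.toMatrixOrthonormal b τ)⁻¹ ⊗ₖ (LinearMap.toMatrixOrthonormal b Z)ᵀ) *ᵥ
      phiVec (LinearMap.toMatrixOrthonormal b X))).re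

/-- The optimized quantum `f`-divergence `Q̃_f(X‖Y)`, the supremum (possibly `+∞`) of
`Q̃_f(X‖Y + ε Π_Y^⊥; τ)` over `τ > 0` with `Tr τ ≤ 1` and `ε > 0`. -/
def optFDiv {ι H : Type*} [Fintype ι] [DecidableEq ι] [NormedAddCommGroup H]
    [InnerProductSpace ℂ H] [FiniteDimensional ℂ H] (b : OrthonormalBasis ι ℂ H)
    (f : ℝ → ℝ) (X Y : H →ₗ[ℂ] H) : EReal :=
  ⨆ (τ : H →ₗ[ℂ] H) (_ : IsPosDef τ) (_ : (LinearMap.trace ℂ H τ).re ≤ 1) (ε : ℝ) (_ : 0 < ε),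
    ((optFDivAt b f X (Y + (ε : ℂ) • kerProj Y) τ : ℝ) : EReal)

end OptFDiv

end

/-! An isometry `U` intertwines `T` with its block extension `T ⊕ c` (equal to `T` on the range of
`U` and to `c` on the complement), so for fixed `τ` the value is the same on both spaces:
`optFDivAt_eq_of_intertwine`. Since `ker (U Y U†)` contains the complement of the range, the
regularisation of `U Y U†` is itself such an extension. Only the trace constraint on `τ` has to be
handled.

For `≤`, `τ` may have trace exactly 1, leaving no room on the complement. Hence `c • τ` with `c < 1`
is extended and `c → 1`. As `τ` enters through its inverse, this limit uses only right-continuity of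
`f`, which operator antitone functions have (`OperatorAntitone.tendsto_nhdsGT`).

For `≥`, every `σ` on the large space lies below some `τ ⊕ c` with `Tr τ ≤ Tr σ`
(`IsPosDef.exists_le_blockExt`). Inversion and `f` both reverse the order, so passing from `σ` to `τ
⊕ c` can only increase the value. -/

namespace OptFDiv

/-! ### Functional calculus and intertwiners -/

open Polynomial in
theorem exists_polynomial_cfc_eq_aeval {m n : Type*} [Fintype m] [DecidableEq m] [Fintype n]
    [DecidableEq n] (f : ℝ → ℝ) {A : Matrix m m ℂ} {B : Matrix n n ℂ} (hA : A.IsHermitian)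
    (hB : B.IsHermitian) : ∃ p : ℝ[X], cfc f A = aeval A p ∧ cfc f B = aeval B p := by
  classical
  let s : Finset ℝ := A.finite_real_spectrum.toFinset ∪ B.finite_real_spectrum.toFinset
  refine ⟨Lagrange.interpolate s id f, ?_, ?_⟩
  · rw [← cfc_polynomial _ A hA]
    refine cfc_congr fun x hx => ?_
    exact (Lagrange.eval_interpolate_at_node f (v := id) (s := s) (i := x)
      Function.injective_id.injOn (by simp [s, hx])).symm
  · rw [← cfc_polynomial _ B hB]
    refine cfc_congr fun x hx => ?_
    exact (Lagrange.eval_interpolate_at_node f (v := id) (s := s) (i := x)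
      Function.injective_id.injOn (by simp [s, hx])).symm

open Polynomial in
theorem aeval_mul_of_intertwine {m n : Type*} [Fintype m] [DecidableEq m] [Fintype n]
    [DecidableEq n] {A : Matrix m m ℂ} {B : Matrix n n ℂ} {W : Matrix m n ℂ} (h : A * W = W * B)
    (p : ℝ[X]) : aeval A p * W = W * aeval B p := by
  induction p using Polynomial.induction_on' with
  | add p q hp hq => simp [Matrix.add_mul, Matrix.mul_add, hp, hq]
  | monomial k a =>
    have hk : A ^ k * W = W * B ^ k := by
      induction k with
      | zero => simp
      | succ k ih => rw [pow_succ, Matrix.mul_assoc, h, ← Matrix.mul_assoc, ih, pow_succ,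
          Matrix.mul_assoc]
    simp [aeval_monomial, ← Algebra.smul_def, hk]

/-- Both spectra are finite, so a single interpolating polynomial computes both sides. No continuity
of `f` is needed. -/
theorem cfc_mul_of_intertwine {m n : Type*} [Fintype m] [DecidableEq m] [Fintype n]
    [DecidableEq n] (f : ℝ → ℝ) {A : Matrix m m ℂ} {B : Matrix n n ℂ} {W : Matrix m n ℂ}
    (hA : A.IsHermitian) (hB : B.IsHermitian) (h : A * W = W * B) :
    cfc f A * W = W * cfc f B := by
  obtain ⟨p, hpA, hpB⟩ := exists_polynomial_cfc_eq_aeval f hA hB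
  rw [hpA, hpB, aeval_mul_of_intertwine h]

theorem cfc_mulVec_of_eigenvector {n : Type*} [Fintype n] [DecidableEq n] (f : ℝ → ℝ)
    {A : Matrix n n ℂ} (hA : A.IsHermitian) {v : n → ℂ} {x : ℝ} (h : A *ᵥ v = (x : ℂ) • v) :
    cfc f A *ᵥ v = (f x : ℂ) • v := by
  have hB : (algebraMap ℝ (Matrix Unit Unit ℂ) x).IsHermitian :=
    IsSelfAdjoint.algebraMap (Matrix Unit Unit ℂ) (IsSelfAdjoint.all x)
  -- An eigenvector is an intertwiner with the `1 × 1` matrix `x`.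
  have key := cfc_mul_of_intertwine f hA hB (W := Matrix.replicateCol Unit v) (by
    ext i j
    have := congrFun h i
    simpa [Matrix.mul_apply, Matrix.mulVec, dotProduct, Algebra.algebraMap_eq_smul_one,
      Matrix.smul_apply, mul_comm] using this)
  rw [cfc_algebraMap] at key
  ext i
  have := congrFun (congrFun key i) ()
  simpa [Matrix.mul_apply, Matrix.mulVec, dotProduct, Algebra.algebraMap_eq_smul_one,
      Matrix.smul_apply, mul_comm] using this

theorem cfc_submatrix_equiv {m n : Type*} [Fintype m] [DecidableEq m] [Fintype n]
    [DecidableEq n] (f : ℝ → ℝ) {A : Matrix m m ℂ} (hA : A.IsHermitian) (e : n ≃ m) :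
    cfc f (A.submatrix e e) = (cfc f A).submatrix e e := by
  obtain ⟨p, hpA, hpB⟩ := exists_polynomial_cfc_eq_aeval f hA (hA.submatrix e)
  have := Polynomial.aeval_algHom_apply (Matrix.reindexAlgEquiv ℝ ℂ e.symm).toAlgHom A p
  rw [hpA, hpB]
  simpa using this

/-! ### Operator order and right-continuity of antitone functions -/

theorem OperatorAntitone.posSemidef_sub {n : Type*} [Fintype n] [DecidableEq n] {f : ℝ → ℝ}
    (hf : OperatorAntitone f) {A B : Matrix n n ℂ} (hA : A.PosDef) (hB : B.PosDef)
    (hAB : (B - A).PosSemidef) : (cfc f A - cfc f B).PosSemidef := by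
  let e := (Fintype.equivFin n).symm
  have := hf _ (A.submatrix e e) (B.submatrix e e) (hA.submatrix e.injective)
    (hB.submatrix e.injective) (hAB.submatrix e)
  rw [cfc_submatrix_equiv f hA.1, cfc_submatrix_equiv f hB.1] at this
  exact (Matrix.posSemidef_submatrix_equiv e).1 this

theorem posSemidef_inv_sub_inv {n : Type*} [Fintype n] [DecidableEq n] {A B : Matrix n n ℂ}
    (hA : A.PosDef) (hB : B.PosDef) (hAB : (B - A).PosSemidef) : (A⁻¹ - B⁻¹).PosSemidef := by
  have h1 := hAB.mul_mul_conjTranspose_same B⁻¹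
  have h2 := hA.inv.posSemidef.mul_mul_conjTranspose_same (B⁻¹ * (B - A))
  rw [Matrix.conjTranspose_mul, hB.inv.1.eq, hAB.1.eq] at h2
  rw [hB.inv.1.eq] at h1
  have hA' := (Matrix.isUnit_iff_isUnit_det _).1 hA.isUnit
  have hB' := (Matrix.isUnit_iff_isUnit_det _).1 hB.isUnit
  -- `A⁻¹ - B⁻¹ = B⁻¹(B - A)B⁻¹ + B⁻¹(B - A)A⁻¹(B - A)B⁻¹`.
  convert h1.add h2 using 1
  have hL : B⁻¹ * (B - A) = 1 - B⁻¹ * A := by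
    rw [Matrix.mul_sub, Matrix.nonsing_inv_mul _ hB']
  have hR : (B - A) * B⁻¹ = 1 - A * B⁻¹ := by
    rw [Matrix.sub_mul, Matrix.mul_nonsing_inv _ hB']
  rw [hL, hR]
  simp only [Matrix.sub_mul, Matrix.mul_sub, Matrix.one_mul, Matrix.mul_one, Matrix.mul_assoc,
    Matrix.mul_nonsing_inv _ hA', Matrix.nonsing_inv_mul_cancel_left _ _ hA']
  abel

/-- An operator antitone function satisfies a concavity type inequality, read off from a
two-by-two matrix with eigenvalues `x` and `y` dominated by `diag (z, c)`. -/
theorem OperatorAntitone.le_add {f : ℝ → ℝ} (hf : OperatorAntitone f) {x y z t : ℝ} (hx : 0 < x)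
    (hy : 0 < y) (hz : t ^ 2 * x + y < (1 + t ^ 2) * z) :
    (1 + t ^ 2) * f z ≤ t ^ 2 * f x + f y := by
  have hs : 0 < 1 + t ^ 2 := by positivity
  set s := 1 + t ^ 2 with hsd
  have hz0 : 0 < z := by
    by_contra h
    nlinarith [mul_nonneg (sq_nonneg t) hx.le]
  set α : ℝ := s * z - (t ^ 2 * x + y) with hα
  have hα0 : 0 < α := by linarith
  set β : ℝ := -(t * (x - y)) with hβ
  -- This `c` makes the Schur complement of `C - A` vanish: `C - A` is the rank-one matrix of `(α,
  -- β)` divided by `α * s`.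
  set c : ℝ := (x + t ^ 2 * y + β ^ 2 / α) / s with hc
  have hc0 : 0 < c := by positivity
  let A : Matrix (Fin 2) (Fin 2) ℂ :=
    !![(((t ^ 2 * x + y) / s : ℝ) : ℂ), ((t * (x - y) / s : ℝ) : ℂ);
      ((t * (x - y) / s : ℝ) : ℂ), (((x + t ^ 2 * y) / s : ℝ) : ℂ)]
  let R : Matrix (Fin 2) (Fin 2) ℂ := !![(t : ℂ), 1; 1, -(t : ℂ)]
  let D : Matrix (Fin 2) (Fin 2) ℂ := Matrix.diagonal ![((x / s : ℝ) : ℂ), ((y / s : ℝ) : ℂ)]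
  let C : Matrix (Fin 2) (Fin 2) ℂ := Matrix.diagonal ![((z : ℝ) : ℂ), ((c : ℝ) : ℂ)]
  have hR : Rᴴ = R := by
    ext i j
    fin_cases i <;> fin_cases j <;> simp [R]
  have hD : D.PosDef := by
    refine Matrix.PosDef.diagonal fun i => ?_
    fin_cases i
    · simpa using (Complex.zero_lt_real.2 (div_pos hx hs))
    · simpa using (Complex.zero_lt_real.2 (div_pos hy hs))
  have hC : C.PosDef := by
    refine Matrix.PosDef.diagonal fun i => ?_
    fin_cases i
    · simpa using hz0
    · simpa using hc0
  have hARD : A = Rᴴ * D * R := by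
    rw [hR]
    ext i j
    fin_cases i <;> fin_cases j <;> simp [A, R, D, Matrix.mul_apply, Matrix.vecMul_diagonal, Fin.sum_univ_two] <;> ring
  have hRinj : Function.Injective R.mulVec := by
    apply Matrix.mulVec_injective_of_isUnit
    rw [Matrix.isUnit_iff_isUnit_det, isUnit_iff_ne_zero]
    have : R.det = ((-s : ℝ) : ℂ) := by
      simp [R, Matrix.det_fin_two, hsd]
      ring
    rw [this]
    exact_mod_cast (neg_neg_of_pos hs).ne
  have hA : A.PosDef := hARD ▸ hD.conjTranspose_mul_mul_same hRinj
  have hCA : (C - A).PosSemidef := by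
    have h0 := (Matrix.posSemidef_vecMulVec_self_star ![(α : ℂ), (β : ℂ)]).smul
      (a := (1 / (α * s) : ℝ)) (by positivity)
    convert h0 using 1
    have hsc : (s : ℂ) ≠ 0 := by exact_mod_cast hs.ne'
    have hαc : (α : ℂ) ≠ 0 := by exact_mod_cast hα0.ne'
    ext i j
    fin_cases i <;> fin_cases j
    · rw [Matrix.smul_apply, Matrix.vecMulVec_apply]
      simp [C, A]
      field_simp
      simp [hα]
      ring
    · rw [Matrix.smul_apply, Matrix.vecMulVec_apply]
      simp [C, A]
      field_simp
      simp [hβ]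
    · rw [Matrix.smul_apply, Matrix.vecMulVec_apply]
      simp [C, A]
      field_simp
      simp [hβ]
    · rw [Matrix.smul_apply, Matrix.vecMulVec_apply]
      simp [C, A, hc]
      field_simp
      ring
  have hfin := hf 2 A C hA hC hCA
  have hsc : (s : ℂ) ≠ 0 := by exact_mod_cast hs.ne'
  have hsc' : (s : ℂ) = 1 + (t : ℂ) ^ 2 := by simp [hsd]
  have hu : A *ᵥ ![(t : ℂ), 1] = (x : ℂ) • ![(t : ℂ), 1] := by
    ext i
    fin_cases i <;> simp [A, Matrix.mulVec, dotProduct, Fin.sum_univ_two] <;> field_simp <;>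
      rw [hsc'] <;> ring
  have hv : A *ᵥ ![1, -(t : ℂ)] = (y : ℂ) • ![1, -(t : ℂ)] := by
    ext i
    fin_cases i <;> simp [A, Matrix.mulVec, dotProduct, Fin.sum_univ_two] <;> field_simp <;>
      rw [hsc'] <;> ring
  have he : C *ᵥ ![1, 0] = (z : ℂ) • ![1, 0] := by
    ext i
    fin_cases i <;> simp [C, Matrix.mulVec, dotProduct, Fin.sum_univ_two]
  have hu' := cfc_mulVec_of_eigenvector f hA.1 hu
  have hv' := cfc_mulVec_of_eigenvector f hA.1 hv
  have he' := cfc_mulVec_of_eigenvector f hC.1 he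
  have hsplit : (s : ℂ) • ![(1 : ℂ), 0] = (t : ℂ) • ![(t : ℂ), 1] + ![1, -(t : ℂ)] := by
    ext i
    fin_cases i <;> simp [hsc']; ring
  have hAe : (s : ℂ) • (cfc f A *ᵥ ![1, 0]) =
      (t : ℂ) • ((f x : ℂ) • ![(t : ℂ), 1]) + (f y : ℂ) • ![1, -(t : ℂ)] := by
    rw [← Matrix.mulVec_smul, hsplit, Matrix.mulVec_add, Matrix.mulVec_smul, hu', hv']
  have hpos := hfin.dotProduct_mulVec_nonneg ![1, 0]
  rw [Matrix.sub_mulVec, he'] at hpos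
  have h00 := congrFun hAe 0
  simp only [Pi.smul_apply, Pi.add_apply, smul_eq_mul, Matrix.cons_val_zero] at h00
  have h1 : (cfc f A *ᵥ ![1, 0]) 0 = (((t ^ 2 * f x + f y) / s : ℝ) : ℂ) := by
    push_cast
    rw [eq_div_iff hsc, mul_comm, h00]
    ring
  generalize cfc f A *ᵥ ![1, 0] = w at hpos h1
  have h2 : (0 : ℂ) ≤ (((t ^ 2 * f x + f y) / s - f z : ℝ) : ℂ) := by
    simpa [dotProduct, Fin.sum_univ_two, h1] using hpos
  have h3 := Complex.zero_le_real.1 h2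
  rw [sub_nonneg, le_div_iff₀ hs] at h3
  linarith

theorem OperatorAntitone.antitoneOn {f : ℝ → ℝ} (hf : OperatorAntitone f) :
    AntitoneOn f (Set.Ioi 0) := by
  intro x hx y hy hxy
  rcases hxy.eq_or_lt with rfl | h
  · rfl
  · simpa using hf.le_add (x := x) (y := x) (z := y) (t := 0) hx hx (by simpa using h)

open Filter Topology in
theorem OperatorAntitone.tendsto_nhdsGT {f : ℝ → ℝ} (hf : OperatorAntitone f) {z : ℝ}
    (hz : 0 < z) : Tendsto f (𝓝[>] z) (𝓝 (f z)) := by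
  have hanti := hf.antitoneOn
  refine tendsto_order.2 ⟨fun a ha => ?_, fun a ha => ?_⟩
  -- The concavity inequality with left point `z / 2` bounds `f y` below for `y` slightly above `z`;
  -- the error vanishes with `t`.
  · obtain ⟨t, ht0, ht⟩ : ∃ t : ℝ, 0 < t ∧ t ^ 2 * f (z / 2) + a < (1 + t ^ 2) * f z := by
      have h : Tendsto (fun t : ℝ => (1 + t ^ 2) * f z - (t ^ 2 * f (z / 2) + a)) (𝓝[>] 0)
          (𝓝 (f z - a)) := by
        have : Continuous fun t : ℝ => (1 + t ^ 2) * f z - (t ^ 2 * f (z / 2) + a) := by fun_prop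
        simpa using (this.tendsto 0).mono_left nhdsWithin_le_nhds
      obtain ⟨t, h1, h2⟩ := ((h.eventually (lt_mem_nhds (sub_pos.2 ha))).and
        self_mem_nhdsWithin).exists
      exact ⟨t, h2, by linarith⟩
    have hlt : z < z + t ^ 2 * z / 2 := by
      have : 0 < t ^ 2 * z / 2 := by positivity
      linarith
    filter_upwards [Ioo_mem_nhdsGT hlt] with y hy
    have := hf.le_add (x := z / 2) (y := y) (z := z) (t := t) (by positivity)
      (hz.trans hy.1) (by nlinarith [hy.2])
    linarith
  · filter_upwards [self_mem_nhdsWithin] with y hy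
    exact (hanti hz (hz.trans hy) (le_of_lt hy)).trans_lt ha

/-! ### The vector `φ^X` under an isometry -/

theorem phiVec_eq_vec {ι : Type*} [Fintype ι] [DecidableEq ι] (M : Matrix ι ι ℂ) :
    phiVec M = (cfc Real.sqrt M)ᵀ.vec := by
  ext p
  simp only [phiVec, gammaVec, Matrix.mulVec, dotProduct, Fintype.sum_prod_type,
    Matrix.kroneckerMap_apply, Matrix.one_apply, Matrix.vec, Matrix.transpose_apply]
  simp

theorem cfc_conj_isometry {ι κ : Type*} [Fintype ι] [DecidableEq ι] [Fintype κ] [DecidableEq κ]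
    {g : ℝ → ℝ} (hg : g 0 = 0) {V : Matrix κ ι ℂ} (hV : Vᴴ * V = 1) {M : Matrix ι ι ℂ}
    (hM : M.IsHermitian) : cfc g (V * M * Vᴴ) = V * cfc g M * Vᴴ := by
  have hM' : (V * M * Vᴴ).IsHermitian := Matrix.isHermitian_mul_mul_conjTranspose V hM
  have h1 : cfc g (V * M * Vᴴ) * V = V * cfc g M :=
    cfc_mul_of_intertwine g hM' hM (by rw [Matrix.mul_assoc _ Vᴴ V, hV, Matrix.mul_one])
  -- On the complement of the range the operator is zero, and there `g 0 = 0` enters.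
  have h2 : cfc g (V * M * Vᴴ) * (1 - V * Vᴴ) = (1 - V * Vᴴ) * cfc g (0 : Matrix κ κ ℂ) :=
    cfc_mul_of_intertwine g hM' Matrix.isHermitian_zero (by
      rw [Matrix.mul_sub, Matrix.mul_one, Matrix.mul_assoc _ Vᴴ (V * Vᴴ), ← Matrix.mul_assoc Vᴴ,
        hV, Matrix.one_mul, sub_self, Matrix.mul_zero])
  rw [cfc_apply_zero, hg, map_zero, Matrix.mul_zero, Matrix.mul_sub, Matrix.mul_one, sub_eq_zero,
    ← Matrix.mul_assoc, h1] at h2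
  exact h2

theorem phiVec_conj_isometry {ι κ : Type*} [Fintype ι] [DecidableEq ι] [Fintype κ]
    [DecidableEq κ] {V : Matrix κ ι ℂ} (hV : Vᴴ * V = 1) {M : Matrix ι ι ℂ}
    (hM : M.IsHermitian) : phiVec (V * M * Vᴴ) = (V ⊗ₖ Vᴴᵀ) *ᵥ phiVec M := by
  rw [phiVec_eq_vec, phiVec_eq_vec, Matrix.kronecker_mulVec_vec,
    cfc_conj_isometry Real.sqrt_zero hV hM, Matrix.transpose_mul, Matrix.transpose_mul,
    Matrix.mul_assoc]

/-! ### The functional at fixed `τ`: invariance, monotonicity, scaling -/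

section Operators

variable {HS HR ι κ : Type*}
    [NormedAddCommGroup HS] [InnerProductSpace ℂ HS] [FiniteDimensional ℂ HS]
    [NormedAddCommGroup HR] [InnerProductSpace ℂ HR] [FiniteDimensional ℂ HR]
    [Fintype ι] [DecidableEq ι] [Fintype κ] [DecidableEq κ]

open LinearMap

omit [FiniteDimensional ℂ HS] in
theorem IsPosDef.isPositive {τ : HS →ₗ[ℂ] HS} (hτ : IsPosDef τ) : τ.IsPositive := by
  refine ⟨hτ.1, fun x => ?_⟩
  rcases eq_or_ne x 0 with rfl | hx
  · simp
  · exact (hτ.2 x hx).le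

theorem IsPosDef.posDef_toMatrix (b : OrthonormalBasis ι ℂ HS) {τ : HS →ₗ[ℂ] HS}
    (hτ : IsPosDef τ) : (toMatrixOrthonormal b τ).PosDef := by
  have hpsd : (toMatrixOrthonormal b τ).PosSemidef :=
    (posSemidef_toMatrix_iff b).2 hτ.isPositive
  refine hpsd.posDef_iff_isUnit.2 ?_
  refine IsUnit.map (toMatrixOrthonormal b) ((LinearMap.isUnit_iff_ker_eq_bot τ).2 ?_)
  refine LinearMap.ker_eq_bot'.2 fun x hx => ?_
  by_contra h
  have := hτ.2 x h
  simp [hx] at this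

/-- With `V` the matrix of `U`, the isometry `V ⊗ conj V` carries `φ^X` to `φ^{UXU†}` and
intertwines the two arguments of `f`. What `Z'` and `σ` do off the range is irrelevant. -/
theorem optFDivAt_eq_of_intertwine (bS : OrthonormalBasis ι ℂ HS) (bR : OrthonormalBasis κ ℂ HR)
    (f : ℝ → ℝ) (U : HS →ₗᵢ[ℂ] HR) {X Z τ : HS →ₗ[ℂ] HS} {Z' σ : HR →ₗ[ℂ] HR}
    (hX : X.IsPositive) (hZ : IsPosDef Z) (hZ' : IsPosDef Z') (hτ : IsPosDef τ)
    (hσ : IsPosDef σ) (hZU : Z' ∘ₗ U.toLinearMap = U.toLinearMap ∘ₗ Z)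
    (hσU : σ ∘ₗ U.toLinearMap = U.toLinearMap ∘ₗ τ) :
    optFDivAt bR f (U.toLinearMap ∘ₗ X ∘ₗ adjoint U.toLinearMap) Z' σ = optFDivAt bS f X Z τ := by
  set V : Matrix κ ι ℂ := toMatrix bS.toBasis bR.toBasis U.toLinearMap with hVdef
  have hVadj : toMatrix bR.toBasis bS.toBasis (adjoint U.toLinearMap) = Vᴴ :=
    LinearMap.toMatrix_adjoint bS bR _
  have hUU : adjoint U.toLinearMap ∘ₗ U.toLinearMap = LinearMap.id := by
    refine LinearMap.ext fun x => ext_inner_right ℂ fun y => ?_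
    simp
  have hV : Vᴴ * V = 1 := by
    rw [← hVadj, hVdef, ← LinearMap.toMatrix_comp, hUU, LinearMap.toMatrix_id]
  have hMX : toMatrixOrthonormal bR (U.toLinearMap ∘ₗ X ∘ₗ adjoint U.toLinearMap) =
      V * toMatrixOrthonormal bS X * Vᴴ := by
    change toMatrix bR.toBasis bR.toBasis _ = V * toMatrix bS.toBasis bS.toBasis X * Vᴴ
    rw [← hVadj, hVdef, LinearMap.toMatrix_comp _ bS.toBasis, LinearMap.toMatrix_comp _ bS.toBasis,
      Matrix.mul_assoc]
  have hXm : (toMatrixOrthonormal bS X).IsHermitian := ((posSemidef_toMatrix_iff bS).2 hX).1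
  have hconj : ∀ {T' : HR →ₗ[ℂ] HR} {T : HS →ₗ[ℂ] HS},
      T' ∘ₗ U.toLinearMap = U.toLinearMap ∘ₗ T →
      toMatrixOrthonormal bR T' * V = V * toMatrixOrthonormal bS T := by
    intro T' T h
    change toMatrix bR.toBasis bR.toBasis T' * V = V * toMatrix bS.toBasis bS.toBasis T
    rw [hVdef, ← LinearMap.toMatrix_comp, ← LinearMap.toMatrix_comp, h]
  have hτm := hτ.posDef_toMatrix bS
  have hσm := hσ.posDef_toMatrix bR
  have hZm := hZ.posDef_toMatrix bS
  have hZm' := hZ'.posDef_toMatrix bR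
  have h1 := hconj hZU
  have h2 := hconj hσU
  unfold optFDivAt
  rw [hMX, phiVec_conj_isometry hV hXm]
  generalize toMatrixOrthonormal bS X = MX at *
  generalize toMatrixOrthonormal bS Z = MZ at *
  generalize toMatrixOrthonormal bR Z' = MZ' at *
  generalize toMatrixOrthonormal bS τ = Mτ at *
  generalize toMatrixOrthonormal bR σ = Mσ at *
  have hσi : Mσ⁻¹ * V = V * Mτ⁻¹ := by
    have ha := (Matrix.isUnit_iff_isUnit_det _).1 hσm.isUnit
    have hb := (Matrix.isUnit_iff_isUnit_det _).1 hτm.isUnit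
    calc Mσ⁻¹ * V = Mσ⁻¹ * (V * Mτ) * Mτ⁻¹ := by
          rw [Matrix.mul_assoc, Matrix.mul_assoc, Matrix.mul_nonsing_inv _ hb, Matrix.mul_one]
      _ = V * Mτ⁻¹ := by
          rw [← h2, ← Matrix.mul_assoc, Matrix.nonsing_inv_mul _ ha, Matrix.one_mul]
  have hZt : MZ'ᵀ * Vᴴᵀ = Vᴴᵀ * MZᵀ := by
    rw [← Matrix.transpose_mul, ← Matrix.transpose_mul]
    have := congrArg Matrix.conjTranspose h1
    rw [Matrix.conjTranspose_mul, Matrix.conjTranspose_mul, hZm.1.eq, hZm'.1.eq] at this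
    rw [this]
  have hW : (Mσ⁻¹ ⊗ₖ MZ'ᵀ) * (V ⊗ₖ Vᴴᵀ) = (V ⊗ₖ Vᴴᵀ) * (Mτ⁻¹ ⊗ₖ MZᵀ) := by
    rw [← Matrix.mul_kronecker_mul, ← Matrix.mul_kronecker_mul, hσi, hZt]
  have hWW : (V ⊗ₖ Vᴴᵀ)ᴴ * (V ⊗ₖ Vᴴᵀ) = 1 := by
    rw [Matrix.conjTranspose_kronecker, ← Matrix.mul_kronecker_mul, hV]
    have : Vᴴᵀᴴ * Vᴴᵀ = (Vᴴ * V)ᵀ := by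
      rw [Matrix.transpose_mul]
      congr 1
      ext i j
      simp
    rw [this, hV, Matrix.transpose_one, Matrix.one_kronecker_one]
  have hcfc := cfc_mul_of_intertwine f (hσm.inv.kronecker hZm'.transpose).1
    (hτm.inv.kronecker hZm.transpose).1 hW
  rw [Matrix.mulVec_mulVec, hcfc, Matrix.star_mulVec, ← Matrix.mulVec_mulVec,
    ← Matrix.dotProduct_mulVec, Matrix.mulVec_mulVec _ _ (V ⊗ₖ Vᴴᵀ), hWW, Matrix.one_mulVec]

theorem optFDivAt_mono (b : OrthonormalBasis ι ℂ HS) {f : ℝ → ℝ} (hf : OperatorAntitone f)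
    (X : HS →ₗ[ℂ] HS) {Z σ τ : HS →ₗ[ℂ] HS} (hZ : IsPosDef Z) (hσ : IsPosDef σ)
    (hτ : IsPosDef τ) (h : (τ - σ).IsPositive) :
    optFDivAt b f X Z σ ≤ optFDivAt b f X Z τ := by
  have hτm := hτ.posDef_toMatrix b
  have hσm := hσ.posDef_toMatrix b
  have hZm := (hZ.posDef_toMatrix b).transpose
  have hm : (toMatrixOrthonormal b τ - toMatrixOrthonormal b σ).PosSemidef := by
    rw [← map_sub]
    exact (posSemidef_toMatrix_iff b).2 h
  have hle := (posSemidef_inv_sub_inv hσm hτm hm).kronecker hZm.posSemidef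
  rw [sub_eq_add_neg, Matrix.add_kronecker, ← neg_one_smul ℂ, Matrix.smul_kronecker,
    neg_one_smul, ← sub_eq_add_neg] at hle
  have := (hf.posSemidef_sub (hτm.inv.kronecker hZm) (hσm.inv.kronecker hZm)
    hle).re_dotProduct_nonneg (phiVec (toMatrixOrthonormal b X))
  rw [Matrix.sub_mulVec, dotProduct_sub, map_sub, sub_nonneg] at this
  exact this

-- Each eigenvalue `λ > 0` becomes `c⁻¹ λ`, which decreases to `λ` as `c` increases to 1; hence
-- one-sided continuity suffices.
open Filter Topology in
theorem tendsto_cfc_smul {n : Type*} [Fintype n] [DecidableEq n] {f : ℝ → ℝ}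
    (hf : ∀ x : ℝ, 0 < x → Tendsto f (𝓝[>] x) (𝓝 (f x))) {A : Matrix n n ℂ} (hA : A.PosDef) :
    Tendsto (fun c : ℝ => cfc f ((c : ℂ)⁻¹ • A)) (𝓝[<] 1) (𝓝 (cfc f A)) := by
  have hG : Continuous fun v : n → ℝ => (hA.1.eigenvectorUnitary : Matrix n n ℂ) *
      Matrix.diagonal (RCLike.ofReal ∘ v : n → ℂ) *
        (star hA.1.eigenvectorUnitary : Matrix n n ℂ) := by
    have : Continuous fun v : n → ℝ => (RCLike.ofReal ∘ v : n → ℂ) := by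
      refine continuous_pi fun i => ?_
      exact RCLike.continuous_ofReal.comp (continuous_apply i)
    exact (continuous_const.matrix_mul this.matrix_diagonal).matrix_mul continuous_const
  have hcfc : ∀ g : ℝ → ℝ, cfc g A = (hA.1.eigenvectorUnitary : Matrix n n ℂ) *
      Matrix.diagonal (RCLike.ofReal ∘ (g ∘ hA.1.eigenvalues) : n → ℂ) *
        (star hA.1.eigenvectorUnitary : Matrix n n ℂ) := fun g => hA.1.cfc_eq g
  have hsmul : ∀ c : ℝ, cfc f ((c : ℂ)⁻¹ • A) = cfc (fun x => f (c⁻¹ * x)) A := by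
    intro c
    refine Eq.trans ?_ (cfc_comp_const_mul c⁻¹ f A
      ((A.finite_real_spectrum.image _).continuousOn _) hA.1).symm
    congr 1
    ext i j
    simp
  simp_rw [hsmul, hcfc]
  refine (hG.tendsto (f ∘ hA.1.eigenvalues)).comp (tendsto_pi_nhds.2 fun i => ?_)
  refine (hf _ (hA.eigenvalues_pos i)).comp ?_
  refine tendsto_nhdsWithin_iff.2 ⟨?_, ?_⟩
  · have : ContinuousAt (fun c : ℝ => c⁻¹ * hA.1.eigenvalues i) 1 := by
      fun_prop (disch := norm_num)
    simpa using this.tendsto.mono_left nhdsWithin_le_nhds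
  · filter_upwards [Ioo_mem_nhdsLT (zero_lt_one (α := ℝ))] with c hc
    exact lt_mul_of_one_lt_left (hA.eigenvalues_pos i) ((one_lt_inv₀ hc.1).2 hc.2)

open Filter Topology in
theorem tendsto_optFDivAt_smul (b : OrthonormalBasis ι ℂ HS) {f : ℝ → ℝ}
    (hf : ∀ x : ℝ, 0 < x → Tendsto f (𝓝[>] x) (𝓝 (f x))) (X : HS →ₗ[ℂ] HS)
    {Z τ : HS →ₗ[ℂ] HS} (hZ : IsPosDef Z) (hτ : IsPosDef τ) :
    Tendsto (fun c : ℝ => optFDivAt b f X Z ((c : ℂ) • τ)) (𝓝[<] 1)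
      (𝓝 (optFDivAt b f X Z τ)) := by
  have hτm := hτ.posDef_toMatrix b
  have hA := hτm.inv.kronecker (hZ.posDef_toMatrix b).transpose
  have hG : Continuous fun M : Matrix (ι × ι) (ι × ι) ℂ =>
      (star (phiVec (toMatrixOrthonormal b X)) ⬝ᵥ
        (M *ᵥ phiVec (toMatrixOrthonormal b X))).re :=
    Complex.continuous_re.comp
      (continuous_const.dotProduct (continuous_id.matrix_mulVec continuous_const))
  refine ((hG.tendsto _).comp (tendsto_cfc_smul hf hA)).congr' ?_
  filter_upwards [Ioo_mem_nhdsLT (zero_lt_one (α := ℝ))] with c hc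
  have hc0 : (c : ℂ) ≠ 0 := by exact_mod_cast hc.1.ne'
  have : ((c : ℂ) • toMatrixOrthonormal b τ)⁻¹ = (c : ℂ)⁻¹ • (toMatrixOrthonormal b τ)⁻¹ := by
    refine Matrix.inv_eq_left_inv ?_
    rw [Matrix.smul_mul, Matrix.mul_smul, smul_smul, inv_mul_cancel₀ hc0, one_smul,
      Matrix.nonsing_inv_mul _ ((Matrix.isUnit_iff_isUnit_det _).1 hτm.isUnit)]
  simp only [Function.comp_apply, optFDivAt, map_smul, this, Matrix.smul_kronecker]

end Operators

/-! ### Block extensions along an isometry -/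

section Dilation

variable {HS HR ι κ : Type*}
    [NormedAddCommGroup HS] [InnerProductSpace ℂ HS] [FiniteDimensional ℂ HS]
    [NormedAddCommGroup HR] [InnerProductSpace ℂ HR] [FiniteDimensional ℂ HR]
    [Fintype ι] [DecidableEq ι] [Fintype κ] [DecidableEq κ]

open LinearMap

theorem adjoint_isometry_apply (U : HS →ₗᵢ[ℂ] HR) (x : HS) :
    adjoint U.toLinearMap (U x) = x :=
  ext_inner_right ℂ fun y => by
    rw [LinearMap.adjoint_inner_left]
    exact U.inner_map_map x y

/-- The operator which is `T` on the range of `U` and the scalar `c` on its complement. -/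
noncomputable def blockExt (U : HS →ₗᵢ[ℂ] HR) (T : HS →ₗ[ℂ] HS) (c : ℝ) : HR →ₗ[ℂ] HR :=
  U.toLinearMap ∘ₗ T ∘ₗ adjoint U.toLinearMap +
    (c : ℂ) • (LinearMap.id - U.toLinearMap ∘ₗ adjoint U.toLinearMap)

theorem blockExt_apply (U : HS →ₗᵢ[ℂ] HR) (T : HS →ₗ[ℂ] HS) (c : ℝ) (x : HR) :
    blockExt U T c x = U (T (adjoint U.toLinearMap x)) +
      (c : ℂ) • (x - U (adjoint U.toLinearMap x)) := rfl

theorem blockExt_comp (U : HS →ₗᵢ[ℂ] HR) (T : HS →ₗ[ℂ] HS) (c : ℝ) :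
    blockExt U T c ∘ₗ U.toLinearMap = U.toLinearMap ∘ₗ T := by
  ext x
  change blockExt U T c (U x) = U (T x)
  rw [blockExt_apply, adjoint_isometry_apply]
  simp

theorem inner_sub_isometry_adjoint (U : HS →ₗᵢ[ℂ] HR) (x : HR) (y : HS) :
    ⟪x - U (adjoint U.toLinearMap x), U y⟫_ℂ = 0 := by
  rw [inner_sub_left, U.inner_map_map, LinearMap.adjoint_inner_left]
  exact sub_self _

theorem inner_blockExt (U : HS →ₗᵢ[ℂ] HR) (T : HS →ₗ[ℂ] HS) (c : ℝ) (x y : HR) :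
    ⟪blockExt U T c x, y⟫_ℂ = ⟪T (adjoint U.toLinearMap x), adjoint U.toLinearMap y⟫_ℂ +
      c * ⟪x - U (adjoint U.toLinearMap x), y - U (adjoint U.toLinearMap y)⟫_ℂ := by
  rw [blockExt_apply, inner_add_left, inner_smul_left, inner_sub_right _ y,
    inner_sub_isometry_adjoint, sub_zero, LinearMap.adjoint_inner_right, Complex.conj_ofReal]
  rfl

theorem re_inner_blockExt_self (U : HS →ₗᵢ[ℂ] HR) (T : HS →ₗ[ℂ] HS) (c : ℝ) (x : HR) :
    (⟪blockExt U T c x, x⟫_ℂ).re =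
      (⟪T (adjoint U.toLinearMap x), adjoint U.toLinearMap x⟫_ℂ).re +
        c * ‖x - U (adjoint U.toLinearMap x)‖ ^ 2 := by
  rw [inner_blockExt, inner_self_eq_norm_sq_to_K, Complex.add_re, Complex.re_ofReal_mul]
  norm_cast

theorem IsPosDef.blockExt {U : HS →ₗᵢ[ℂ] HR} {T : HS →ₗ[ℂ] HS} (hT : IsPosDef T) {c : ℝ}
    (hc : 0 < c) : IsPosDef (blockExt U T c) := by
  refine ⟨fun x y => ?_, fun x hx => ?_⟩
  · rw [inner_blockExt, ← inner_conj_symm x, inner_blockExt, map_add, map_mul, inner_conj_symm,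
      inner_conj_symm, Complex.conj_ofReal, hT.1]
  · rw [re_inner_blockExt_self]
    by_cases h : adjoint U.toLinearMap x = 0
    · have : 0 < ‖x‖ := norm_pos_iff.2 hx
      simp only [h, map_zero, inner_zero_left, sub_zero, Complex.zero_re, zero_add]
      positivity
    · have := hT.2 _ h
      positivity

theorem trace_conj_isometry (U : HS →ₗᵢ[ℂ] HR) (T : HS →ₗ[ℂ] HS) :
    LinearMap.trace ℂ HR (U.toLinearMap ∘ₗ T ∘ₗ adjoint U.toLinearMap) =
      LinearMap.trace ℂ HS T := by
  rw [LinearMap.trace_comp_comm', LinearMap.comp_assoc]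
  congr 1
  ext x
  simp

theorem trace_blockExt_le (U : HS →ₗᵢ[ℂ] HR) (T : HS →ₗ[ℂ] HS) {c : ℝ} (hc : 0 ≤ c) :
    (LinearMap.trace ℂ HR (blockExt U T c)).re ≤
      (LinearMap.trace ℂ HS T).re + c * Module.finrank ℂ HR := by
  have h := trace_conj_isometry U LinearMap.id
  rw [LinearMap.id_comp] at h
  rw [blockExt, map_add, map_smul, map_sub, trace_conj_isometry, h, LinearMap.trace_id,
    LinearMap.trace_id, smul_eq_mul, Complex.add_re, Complex.re_ofReal_mul]
  have : (0 : ℝ) ≤ c * Module.finrank ℂ HS := by positivity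
  simp only [Complex.sub_re, Complex.natCast_re]
  linarith

/-- The kernel of `U Y U†` is `U (ker Y)` plus the complement of the range. -/
theorem kerProj_conj_isometry (U : HS →ₗᵢ[ℂ] HR) (Y : HS →ₗ[ℂ] HS) :
    kerProj (U.toLinearMap ∘ₗ Y ∘ₗ adjoint U.toLinearMap) = blockExt U (kerProj Y) 1 := by
  ext x
  refine Submodule.eq_starProjection_of_mem_of_inner_eq_zero
    (K := ker (U.toLinearMap ∘ₗ Y ∘ₗ adjoint U.toLinearMap)) ?_ fun w hw => ?_
  · have hmem : Y (kerProj Y (adjoint U.toLinearMap x)) = 0 :=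
      (ker Y).starProjection_apply_mem (adjoint U.toLinearMap x)
    rw [LinearMap.mem_ker, blockExt_apply]
    simp only [LinearMap.comp_apply, map_add, map_smul, map_sub]
    rw [adjoint_isometry_apply, adjoint_isometry_apply]
    simp [hmem]
  · have hw' : adjoint U.toLinearMap w ∈ ker Y := by
      rw [LinearMap.mem_ker]
      exact (map_eq_zero_iff U U.injective).1 hw
    have : x - blockExt U (kerProj Y) 1 x =
        U (adjoint U.toLinearMap x - kerProj Y (adjoint U.toLinearMap x)) := by
      rw [blockExt_apply, map_sub, Complex.ofReal_one, one_smul]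
      abel
    rw [this]
    have h2 := (ker Y).starProjection_inner_eq_zero (adjoint U.toLinearMap x) _ hw'
    rw [LinearMap.adjoint_inner_right] at h2
    exact h2

theorem add_smul_kerProj_conj_isometry (U : HS →ₗᵢ[ℂ] HR) (Y : HS →ₗ[ℂ] HS) (ε : ℝ) :
    U.toLinearMap ∘ₗ Y ∘ₗ adjoint U.toLinearMap +
        (ε : ℂ) • kerProj (U.toLinearMap ∘ₗ Y ∘ₗ adjoint U.toLinearMap) =
      blockExt U (Y + (ε : ℂ) • kerProj Y) ε := by
  rw [kerProj_conj_isometry]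
  ext x
  simp only [blockExt_apply, LinearMap.add_apply, LinearMap.smul_apply, LinearMap.comp_apply,
    LinearIsometry.coe_toLinearMap, map_add, map_smul, smul_add, Complex.ofReal_one, one_smul,
    add_assoc]

omit [FiniteDimensional ℂ HS] in
theorem apply_eq_zero_of_re_inner_eq_zero {Y : HS →ₗ[ℂ] HS} (hY : Y.IsPositive) {x : HS}
    (hx : (⟪Y x, x⟫_ℂ).re = 0) : Y x = 0 := by
  -- Positivity at `x - t • Y x`; with zero constant term, the discriminant forces `Y x = 0`.
  have key : ∀ t : ℝ, 0 ≤ (⟪Y (Y x), Y x⟫_ℂ).re * (t * t) + (-(2 * ‖Y x‖ ^ 2)) * t + 0 := by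
    intro t
    have h := hY.re_inner_nonneg_left (x - (t : ℂ) • Y x)
    have hn : (⟪Y x, Y x⟫_ℂ).re = ‖Y x‖ ^ 2 := inner_self_eq_norm_sq (𝕜 := ℂ) _
    have hn' : (⟪Y (Y x), x⟫_ℂ).re = ‖Y x‖ ^ 2 := by rw [hY.isSymmetric, hn]
    simp only [map_sub, map_smul, inner_sub_left, inner_sub_right, inner_smul_left,
      inner_smul_right, Complex.conj_ofReal, RCLike.re_to_complex, Complex.re_ofReal_mul,
      hx, hn', Complex.sub_re, hn] at h
    linarith
  have h := discrim_le_zero key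
  rw [discrim, mul_zero, sub_zero] at h
  have h0 : -(2 * ‖Y x‖ ^ 2) = 0 := pow_eq_zero_iff two_ne_zero |>.1 (le_antisymm h (sq_nonneg _))
  simpa using h0

theorem isPosDef_add_smul_kerProj {Y : HS →ₗ[ℂ] HS} (hY : Y.IsPositive) {ε : ℝ} (hε : 0 < ε) :
    IsPosDef (Y + (ε : ℂ) • kerProj Y) := by
  have hP : (kerProj Y).IsPositive :=
    (Submodule.isSymmetricProjection_starProjection (ker Y)).isPositive
  have hεP : ((ε : ℂ) • kerProj Y).IsPositive := hP.smul_of_nonneg (by exact_mod_cast hε.le)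
  refine ⟨(hY.add hεP).1, fun x hx => ?_⟩
  have h1 : 0 ≤ (⟪Y x, x⟫_ℂ).re := hY.re_inner_nonneg_left x
  rw [LinearMap.add_apply, inner_add_left, Complex.add_re, LinearMap.smul_apply, inner_smul_left,
    Complex.conj_ofReal, Complex.re_ofReal_mul]
  rcases h1.eq_or_lt with h0 | h0
  · have hker : kerProj Y x = x :=
      Submodule.starProjection_eq_self_iff.2 (apply_eq_zero_of_re_inner_eq_zero hY h0.symm)
    have hxx : (⟪x, x⟫_ℂ).re = ‖x‖ ^ 2 := inner_self_eq_norm_sq (𝕜 := ℂ) _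
    have : 0 < ‖x‖ := norm_pos_iff.2 hx
    rw [← h0, hker, hxx]
    positivity
  · have : 0 ≤ (⟪kerProj Y x, x⟫_ℂ).re := hP.re_inner_nonneg_left x
    positivity

omit [FiniteDimensional ℂ HS] in
theorem IsPosDef.smul {T : HS →ₗ[ℂ] HS} (hT : IsPosDef T) {c : ℝ} (hc : 0 < c) :
    IsPosDef ((c : ℂ) • T) := by
  refine ⟨fun x y => ?_, fun x hx => ?_⟩
  · rw [LinearMap.smul_apply, LinearMap.smul_apply, inner_smul_left, inner_smul_right, hT.1 x y,
      Complex.conj_ofReal]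
  · have := hT.2 x hx
    rw [LinearMap.smul_apply, inner_smul_left, Complex.conj_ofReal, Complex.re_ofReal_mul]
    positivity

/-! ### Dominating `σ` by a block extension without raising the trace -/

theorem IsPosDef.compress {σ : HR →ₗ[ℂ] HR} (hσ : IsPosDef σ) (U : HS →ₗᵢ[ℂ] HR) :
    IsPosDef (adjoint U.toLinearMap ∘ₗ σ ∘ₗ U.toLinearMap) := by
  refine ⟨fun x y => ?_, fun x hx => ?_⟩
  · simp only [LinearMap.comp_apply, LinearMap.adjoint_inner_left, LinearMap.adjoint_inner_right]
    exact hσ.1 _ _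
  · simp only [LinearMap.comp_apply, LinearMap.adjoint_inner_left]
    exact hσ.2 _ ((map_ne_zero_iff U U.injective).2 hx)

/-- The gap is `Tr (Q σ Q)`, with `Q` the projection off the range. If it vanished, `Q σ Q = 0`, and
definiteness of `σ` would give `Q = 0`. -/
theorem IsPosDef.trace_compress_lt {σ : HR →ₗ[ℂ] HR} (hσ : IsPosDef σ) {U : HS →ₗᵢ[ℂ] HR}
    (hU : ¬ Function.Surjective U) :
    (LinearMap.trace ℂ HS (adjoint U.toLinearMap ∘ₗ σ ∘ₗ U.toLinearMap)).re <
      (LinearMap.trace ℂ HR σ).re := by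
  set Q : HR →ₗ[ℂ] HR := LinearMap.id - U.toLinearMap ∘ₗ adjoint U.toLinearMap with hQ
  have hQx : ∀ x, Q x = x - U (adjoint U.toLinearMap x) := fun x => rfl
  have hQs : adjoint Q = Q := by
    rw [hQ, map_sub, LinearMap.adjoint_comp, LinearMap.adjoint_adjoint, LinearMap.adjoint_id]
  have hQQ : Q ∘ₗ Q = Q := by
    ext x
    rw [LinearMap.comp_apply, hQx (Q x), hQx x, map_sub, adjoint_isometry_apply]
    simp
  have htr : LinearMap.trace ℂ HR (Q ∘ₗ σ ∘ₗ Q) = LinearMap.trace ℂ HR σ -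
      LinearMap.trace ℂ HS (adjoint U.toLinearMap ∘ₗ σ ∘ₗ U.toLinearMap) := by
    rw [LinearMap.trace_comp_comm', LinearMap.comp_assoc, hQQ, hQ, LinearMap.comp_sub, map_sub,
      LinearMap.comp_id, ← LinearMap.comp_assoc, LinearMap.trace_comp_comm']
  have hpos : (Q ∘ₗ σ ∘ₗ Q).IsPositive := by
    have := hσ.isPositive.adjoint_conj Q
    rwa [hQs] at this
  have hnn := Complex.le_def.1 hpos.trace_nonneg
  rw [htr] at hnn
  refine lt_of_le_of_ne (by simpa using hnn.1) fun heq => hU fun x => ?_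
  have h0 : LinearMap.trace ℂ HR (Q ∘ₗ σ ∘ₗ Q) = 0 := by
    rw [htr]
    apply Complex.ext
    · simp [heq]
    · simpa using hnn.2.symm
  have hz : Q ∘ₗ σ ∘ₗ Q = 0 := by
    let b := stdOrthonormalBasis ℂ HR
    have hpsd := (posSemidef_toMatrix_iff b).2 hpos
    rw [LinearMap.trace_eq_matrix_trace ℂ b.toBasis, hpsd.trace_eq_zero_iff] at h0
    exact (LinearMap.toMatrix b.toBasis b.toBasis).map_eq_zero_iff.1 h0
  have hQ0 : Q x = 0 := by
    by_contra hne
    have h1 := hσ.2 _ hne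
    have h2 : ⟪σ (Q x), Q x⟫_ℂ = ⟪(Q ∘ₗ σ ∘ₗ Q) x, x⟫_ℂ := by
      rw [LinearMap.comp_apply, LinearMap.comp_apply, ← LinearMap.adjoint_inner_left, hQs]
    rw [h2, hz] at h1
    simp at h1
  exact ⟨adjoint U.toLinearMap x, (sub_eq_zero.1 hQ0).symm⟩

/-- Split `x = a + w` along the range. Positivity of `σ` at `δ a - w` bounds the cross term by
`δ⟨σa,a⟩ + δ⁻¹⟨σw,w⟩`, so inflating the compression by `1 + δ` absorbs the off-diagonal part once
`c` is large. -/
theorem IsPosDef.isPositive_blockExt_sub {σ : HR →ₗ[ℂ] HR} (hσ : IsPosDef σ) (U : HS →ₗᵢ[ℂ] HR)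
    {δ : ℝ} (hδ : 0 < δ) : ∃ c : ℝ, 0 < c ∧ (OptFDiv.blockExt U
      (((1 + δ : ℝ) : ℂ) • (adjoint U.toLinearMap ∘ₗ σ ∘ₗ U.toLinearMap)) c - σ).IsPositive := by
  set N : ℝ := ‖toContinuousLinearMap σ‖ with hN
  have hN0 : 0 ≤ N := norm_nonneg _
  have hc : 0 < (1 + 1 / δ) * (N + 1) := by positivity
  refine ⟨(1 + 1 / δ) * (N + 1), hc,
    (((hσ.compress U).smul (by positivity : 0 < 1 + δ)).blockExt hc).1.sub hσ.1, fun x => ?_⟩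
  rw [LinearMap.sub_apply, inner_sub_left, map_sub, sub_nonneg]
  refine le_of_le_of_eq ?_ (re_inner_blockExt_self U _ _ x).symm
  obtain ⟨a, ha⟩ : ∃ a, U (adjoint U.toLinearMap x) = a := ⟨_, rfl⟩
  obtain ⟨w, hw⟩ : ∃ w, x - a = w := ⟨_, rfl⟩
  have hxa : x = a + w := by rw [← hw]; abel
  have e1 : (⟪(((1 + δ : ℝ) : ℂ) • (adjoint U.toLinearMap ∘ₗ σ ∘ₗ U.toLinearMap))
      (adjoint U.toLinearMap x), adjoint U.toLinearMap x⟫_ℂ).re =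
      (1 + δ) * (⟪σ a, a⟫_ℂ).re := by
    rw [LinearMap.smul_apply, inner_smul_left, Complex.conj_ofReal, Complex.re_ofReal_mul,
      LinearMap.comp_apply, LinearMap.adjoint_inner_left]
    simp only [LinearMap.comp_apply, LinearIsometry.coe_toLinearMap, ha]
  rw [e1, ha, hw]
  have hq := hσ.isPositive.re_inner_nonneg_left ((δ : ℂ) • a - w)
  have hsymm : (⟪σ w, a⟫_ℂ).re = (⟪σ a, w⟫_ℂ).re := by
    rw [hσ.1, ← inner_conj_symm, Complex.conj_re]
  have hqe : RCLike.re ⟪σ ((δ : ℂ) • a - w), (δ : ℂ) • a - w⟫_ℂ =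
      δ ^ 2 * (⟪σ a, a⟫_ℂ).re - 2 * δ * (⟪σ a, w⟫_ℂ).re + (⟪σ w, w⟫_ℂ).re := by
    simp only [map_sub, map_smul, inner_sub_left, inner_sub_right, inner_smul_left,
      inner_smul_right, Complex.conj_ofReal, RCLike.re_to_complex, Complex.sub_re,
      Complex.re_ofReal_mul, hsymm]
    ring
  have hsum : RCLike.re ⟪σ x, x⟫_ℂ =
      (⟪σ a, a⟫_ℂ).re + 2 * (⟪σ a, w⟫_ℂ).re + (⟪σ w, w⟫_ℂ).re := by
    rw [hxa]
    simp only [map_add, inner_add_left, inner_add_right, RCLike.re_to_complex, hsymm]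
    ring
  have hbound : (⟪σ w, w⟫_ℂ).re ≤ (N + 1) * ‖w‖ ^ 2 := by
    calc (⟪σ w, w⟫_ℂ).re ≤ ‖σ w‖ * ‖w‖ := re_inner_le_norm (𝕜 := ℂ) _ _
      _ ≤ N * ‖w‖ * ‖w‖ := by
        gcongr
        exact (toContinuousLinearMap σ).le_opNorm w
      _ ≤ (N + 1) * ‖w‖ ^ 2 := by nlinarith [sq_nonneg ‖w‖]
  rw [hqe] at hq
  have hq' : 2 * (⟪σ a, w⟫_ℂ).re ≤ δ * (⟪σ a, a⟫_ℂ).re + 1 / δ * (⟪σ w, w⟫_ℂ).re := by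
    have : 0 ≤ (δ ^ 2 * (⟪σ a, a⟫_ℂ).re - 2 * δ * (⟪σ a, w⟫_ℂ).re + (⟪σ w, w⟫_ℂ).re) / δ :=
      div_nonneg hq hδ.le
    have e : (δ ^ 2 * (⟪σ a, a⟫_ℂ).re - 2 * δ * (⟪σ a, w⟫_ℂ).re + (⟪σ w, w⟫_ℂ).re) / δ =
      δ * (⟪σ a, a⟫_ℂ).re - 2 * (⟪σ a, w⟫_ℂ).re + 1 / δ * (⟪σ w, w⟫_ℂ).re := by
      field_simp
    linarith
  have := mul_le_mul_of_nonneg_left hbound (by positivity : 0 ≤ 1 + 1 / δ)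
  rw [hsum, mul_assoc]
  linarith

theorem IsPosDef.exists_le_blockExt {σ : HR →ₗ[ℂ] HR} (hσ : IsPosDef σ) (U : HS →ₗᵢ[ℂ] HR) :
    ∃ τ : HS →ₗ[ℂ] HS, IsPosDef τ ∧
      (LinearMap.trace ℂ HS τ).re ≤ (LinearMap.trace ℂ HR σ).re ∧
      ∃ c : ℝ, 0 < c ∧ (OptFDiv.blockExt U τ c - σ).IsPositive := by
  set τ₀ := adjoint U.toLinearMap ∘ₗ σ ∘ₗ U.toLinearMap with hτ₀
  have hτ₀pos : IsPosDef τ₀ := hσ.compress U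
  by_cases hU : Function.Surjective U
  · have hUU : ∀ x, U (adjoint U.toLinearMap x) = x := fun x => by
      obtain ⟨y, rfl⟩ := hU x
      rw [adjoint_isometry_apply]
    have hσe : U.toLinearMap ∘ₗ τ₀ ∘ₗ adjoint U.toLinearMap = σ := by
      ext x
      simp [hτ₀, hUU]
    refine ⟨τ₀, hτ₀pos, ?_, 1, one_pos, ?_⟩
    · rw [← trace_conj_isometry U τ₀, hσe]
    · have : OptFDiv.blockExt U τ₀ 1 - σ = 0 := by
        ext x
        simp [blockExt_apply, hτ₀, hUU]
      rw [this]
      exact isPositive_zero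
  · have hlt := hσ.trace_compress_lt hU
    rw [← hτ₀] at hlt
    have ht0 : 0 ≤ (LinearMap.trace ℂ HS τ₀).re :=
      (Complex.le_def.1 hτ₀pos.isPositive.trace_nonneg).1
    set t := (LinearMap.trace ℂ HS τ₀).re
    set s := (LinearMap.trace ℂ HR σ).re
    -- The strict trace gap pays for the inflation: `(1 + δ) t ≤ s`. The denominator `t + 1` covers
    -- `t = 0`, when the small space is trivial.
    have hδ : 0 < (s - t) / (t + 1) := div_pos (sub_pos.2 hlt) (by linarith)
    obtain ⟨c, hc, hpos⟩ := hσ.isPositive_blockExt_sub U hδ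
    refine ⟨_, hτ₀pos.smul (by positivity : 0 < 1 + (s - t) / (t + 1)), ?_, c, hc, hpos⟩
    rw [map_smul, smul_eq_mul, Complex.re_ofReal_mul]
    have h1 : (s - t) / (t + 1) * t ≤ s - t := by
      rw [div_mul_eq_mul_div, div_le_iff₀ (by linarith)]
      nlinarith
    change (1 + (s - t) / (t + 1)) * t ≤ s
    linarith

/-! ### The two inequalities -/

open Filter Topology in
theorem optFDiv_le_conj_isometry (bS : OrthonormalBasis ι ℂ HS) (bR : OrthonormalBasis κ ℂ HR)
    (U : HS →ₗᵢ[ℂ] HR) {X Y : HS →ₗ[ℂ] HS} (hX : X.IsPositive) (hY : Y.IsPositive) {f : ℝ → ℝ}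
    (hf : ∀ x : ℝ, 0 < x → Tendsto f (𝓝[>] x) (𝓝 (f x))) :
    optFDiv bS f X Y ≤ optFDiv bR f (U.toLinearMap ∘ₗ X ∘ₗ adjoint U.toLinearMap)
      (U.toLinearMap ∘ₗ Y ∘ₗ adjoint U.toLinearMap) := by
  refine iSup₂_le fun τ hτ => iSup₂_le fun htr ε => iSup_le fun hε => ?_
  have hZ := isPosDef_add_smul_kerProj hY hε
  refine le_of_tendsto ((continuous_coe_real_ereal.tendsto _).comp
    (tendsto_optFDivAt_smul bS hf X hZ hτ)) ?_
  filter_upwards [Ioo_mem_nhdsLT (zero_lt_one (α := ℝ))] with c hc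
  have hcτ := hτ.smul hc.1
  -- The trace `1 - c` freed by scaling is spread over the complement.
  set d : ℝ := (1 - c) / (Module.finrank ℂ HR + 1) with hd
  have hd0 : 0 < d := div_pos (sub_pos.2 hc.2) (by positivity)
  have hdtr : (LinearMap.trace ℂ HR (blockExt U ((c : ℂ) • τ) d)).re ≤ 1 := by
    refine (trace_blockExt_le U _ hd0.le).trans ?_
    rw [map_smul, smul_eq_mul, Complex.re_ofReal_mul]
    have h1 : d * (Module.finrank ℂ HR + 1) = 1 - c := div_mul_cancel₀ _ (by positivity)
    have h2 := mul_le_mul_of_nonneg_left htr hc.1.le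
    linarith
  rw [Function.comp_apply, ← optFDivAt_eq_of_intertwine bS bR f U hX hZ (hZ.blockExt hε) hcτ
    (hcτ.blockExt hd0) (blockExt_comp U _ ε) (blockExt_comp U _ d),
    ← add_smul_kerProj_conj_isometry]
  exact le_iSup₂_of_le _ (hcτ.blockExt hd0) (le_iSup₂_of_le hdtr ε (le_iSup_of_le hε le_rfl))

theorem conj_isometry_le_optFDiv (bS : OrthonormalBasis ι ℂ HS) (bR : OrthonormalBasis κ ℂ HR)
    (U : HS →ₗᵢ[ℂ] HR) {X Y : HS →ₗ[ℂ] HS} (hX : X.IsPositive) (hY : Y.IsPositive) {f : ℝ → ℝ}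
    (hf : OperatorAntitone f) :
    optFDiv bR f (U.toLinearMap ∘ₗ X ∘ₗ adjoint U.toLinearMap)
      (U.toLinearMap ∘ₗ Y ∘ₗ adjoint U.toLinearMap) ≤ optFDiv bS f X Y := by
  refine iSup₂_le fun σ hσ => iSup₂_le fun htr ε => iSup_le fun hε => ?_
  have hZ := isPosDef_add_smul_kerProj hY hε
  obtain ⟨τ, hτ, htr', c, hc, hle⟩ := hσ.exists_le_blockExt U
  rw [add_smul_kerProj_conj_isometry]
  refine le_trans (EReal.coe_le_coe_iff.2 (optFDivAt_mono bR hf _ (hZ.blockExt hε) hσ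
    (hτ.blockExt hc) hle)) ?_
  rw [optFDivAt_eq_of_intertwine bS bR f U hX hZ (hZ.blockExt hε) hτ
    (hτ.blockExt hc) (blockExt_comp U _ ε) (blockExt_comp U _ c)]
  exact le_iSup₂_of_le _ hτ (le_iSup₂_of_le (htr'.trans htr) ε (le_iSup_of_le hε le_rfl))

end Dilation

end OptFDiv

theorem mainTheorem3
    {HS HR ι κ : Type*}
    [NormedAddCommGroup HS] [InnerProductSpace ℂ HS] [FiniteDimensional ℂ HS]
    [NormedAddCommGroup HR] [InnerProductSpace ℂ HR] [FiniteDimensional ℂ HR]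
    [Fintype ι] [DecidableEq ι] [Fintype κ] [DecidableEq κ]
    (bS : OrthonormalBasis ι ℂ HS) (bR : OrthonormalBasis κ ℂ HR)
    (U : HS →ₗᵢ[ℂ] HR) (X Y : HS →ₗ[ℂ] HS) (hX : X.IsPositive) (hY : Y.IsPositive)
    (f : ℝ → ℝ) :
    (OptFDiv.OperatorAntitone f →
      OptFDiv.optFDiv bS f X Y =
        OptFDiv.optFDiv bR f
          (U.toLinearMap ∘ₗ X ∘ₗ LinearMap.adjoint U.toLinearMap)
          (U.toLinearMap ∘ₗ Y ∘ₗ LinearMap.adjoint U.toLinearMap)) ∧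
    (ContinuousOn f (Set.Ioi 0) →
      OptFDiv.optFDiv bS f X Y ≤
        OptFDiv.optFDiv bR f
          (U.toLinearMap ∘ₗ X ∘ₗ LinearMap.adjoint U.toLinearMap)
          (U.toLinearMap ∘ₗ Y ∘ₗ LinearMap.adjoint U.toLinearMap)) := by
  refine ⟨fun hf => le_antisymm ?_ (OptFDiv.conj_isometry_le_optFDiv bS bR U hX hY hf),
    fun hf => ?_⟩
  · exact OptFDiv.optFDiv_le_conj_isometry bS bR U hX hY fun x hx => hf.tendsto_nhdsGT hx
  · exact OptFDiv.optFDiv_le_conj_isometry bS bR U hX hY fun x hx =>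
      ((hf.continuousAt (Ioi_mem_nhds hx)).tendsto).mono_left nhdsWithin_le_nhds
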